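/- For $n\in\{2,3\}$ let $n^\omega$ be the space of infinite sequences over $\{0,\dots,n-1\}$, with the uniform (Lebesgue) product measure $\lambda$, $\lambda(\llbracket\sigma\rrbracket)=n^{-|\sigma|}$, where $\llbracket\sigma\rrbracket$ is the set of sequences that extend the finite string $\sigma$. A sequence $x\in n^\omega$ is \emph{Martin-Löf random} if $x\notin\bigcap_i U_i$ for every sequence $(U_i)_{i\in\omega}$ of uniformly $\Sigma^0_1$ (uniformly effectively open) subsets of $n^\omega$ with $\lambda(U_i)\le 2^{-i}$ for all $i$. Let $\sigma_0=\epsilon,\sigma_1=0,\sigma_2=1,\sigma_3=00,\dots$ be the length-lexicographic enumeration of the finite binary strings. For $x\in 3^\omega$ label each nonempty binary string by $\ell_x(\sigma_i)=x(i-1)$, and let $F_x\colon\subseteq 2^\omega\to 2^\omega$ be the partial function for which $F_x(y)$ is the result of removing all $2$'s from the sequence $\ell_x(y\restriction 1),\ell_x(y\restriction 2),\ell_x(y\restriction 3),\dots$; $F_x(y)$ is undefined if only finitely many terms of this sequence differ from $2$. A partial function $F\colon\subseteq 2^\omega\to 2^\omega$ is a \emph{random continuous function} if $F=F_x$ for some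 Martin-Löf random $x\in 3^\omega$. \textbf{Corollary.} For every random continuous function $F$ there is a random continuous function $G$ such that the composition $G\circ F$ is not a random continuous function. Hence the class of random continuous functions is not closed under composition: there are random continuous functions $F$ and $G$ such that $G\circ F$ is not a random continuous function. -/

import Mathlib

namespace RandomFun

/-- The space `n^ω` of infinite sequences over the alphabet `{0, …, n-1}`. -/
abbrev InfSeq (n : ℕ) : Type := ℕ → Fin n

/-- `y ↾ k`, the initial segment of `y` of length `k`. -/
def initSeg {n : ℕ} (y : InfSeq n) (k : ℕ) : List (Fin n) := (List.range k).map y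

/-- `⟦σ⟧`, the set of all sequences that have `σ` as an initial segment. -/
def cylinder {n : ℕ} (σ : List (Fin n)) : Set (InfSeq n) := {y | initSeg y σ.length = σ}

/-- The Lebesgue measure on `n^ω`: the product of the uniform measures on the alphabet. -/
noncomputable def lebesgue (n : ℕ) [NeZero n] : MeasureTheory.Measure (InfSeq n) :=
  MeasureTheory.Measure.infinitePi fun _ : ℕ => (PMF.uniformOfFintype (Fin n)).toMeasure

/-- `(U i)` is a uniformly `Σ⁰₁` sequence: `U i` is the union of the cylinders of the strings
in `W i`, where the set of pairs `(i, σ)` with `σ ∈ W i` is computably enumerable. -/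
def UniformlySigma01 {n : ℕ} (U : ℕ → Set (InfSeq n)) : Prop :=
  ∃ W : ℕ → Set (List (Fin n)),
    REPred (fun p : ℕ × List (Fin n) => p.2 ∈ W p.1) ∧
      ∀ i, U i = ⋃ σ ∈ W i, cylinder σ

/-- Martin-Löf tests for the Lebesgue measure. -/
structure IsMLTest {n : ℕ} [NeZero n] (U : ℕ → Set (InfSeq n)) : Prop where
  sigma : UniformlySigma01 U
  measure_le : ∀ i, lebesgue n (U i) ≤ (2⁻¹ : ENNReal) ^ i

/-- `x` is Martin-Löf random with respect to the Lebesgue measure. -/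
def MLRandom {n : ℕ} [NeZero n] (x : InfSeq n) : Prop :=
  ∀ U : ℕ → Set (InfSeq n), IsMLTest U → x ∉ ⋂ i, U i

/-- The position of a binary string in the length-lexicographic enumeration
`ε, 0, 1, 00, 01, 10, 11, 000, …` (starting with position `0`). The successors `σ0`, `σ1` of the
string at position `m` stand at the positions `2m + 1` and `2m + 2`. -/
def stringIndex (σ : List (Fin 2)) : ℕ := σ.foldl (fun m b => 2 * m + 1 + (b : ℕ)) 0

/-- The label that `x` gives to the nonempty string `σ`: if `σ` is at position `i`, this is the
entry of `x` at `i - 1`. (It is only used at nonempty strings, which have `i ≥ 1`.) -/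
def label (x : InfSeq 3) (σ : List (Fin 2)) : Fin 3 := x (stringIndex σ - 1)

/-- The result of removing all `2`s from `a`. It is defined if infinitely many entries of `a`
differ from `2`, and its `j`-th entry is then the `j`-th entry of `a` that is not `2`. -/
noncomputable def eraseTwos (a : InfSeq 3) : Part (InfSeq 2) where
  Dom := {k | a k ≠ 2}.Infinite
  get h j := (a (Nat.nth (fun k => a k ≠ 2) j)).castLT (by
    have h1 : a (Nat.nth (fun k => a k ≠ 2) j) ≠ 2 := Nat.nth_mem_of_infinite h j
    omega)

/-- The partial function `F_x` on `2^ω` coded by `x`: follow `y` through the labelled binary tree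
and remove the `2`s from the sequence `ℓ_x(y ↾ 1), ℓ_x(y ↾ 2), ℓ_x(y ↾ 3), …`. -/
noncomputable def codedFun (x : InfSeq 3) : InfSeq 2 →. InfSeq 2 :=
  fun y => eraseTwos fun k => label x (initSeg y (k + 1))

/-- Random continuous functions: partial functions on `2^ω` that have a Martin-Löf random code. -/
def IsRandomContinuous (F : InfSeq 2 →. InfSeq 2) : Prop :=
  ∃ x : InfSeq 3, MLRandom x ∧ F = codedFun x

end RandomFun

open MeasureTheory

namespace RandomFun

/-! ### Finite marginals of Lebesgue measure -/

section Marginals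

variable {n : ℕ} [NeZero n]

/-! Let `F = F_x` with `x` random and let `w = F(0^ω)`, which is defined by randomness. Take `G =
F_z`, where `z` lists the odd entries of `x` with every label `1` on the path `w` changed to `0`.
Then `G(w)` has no entry `1`, being either undefined or constantly `0`. A random code has infinitely
many labels `1` along `0^ω`, so its function takes there a value containing a `1`. Hence `G ∘ F` has
no random code.

The point is that `z` is random. The labels along `0^ω` sit at even entries of `x`, so for
Lebesgue-distributed `x` the path `w` is uniform and independent of the odd entries. A single
relabelled path would destroy randomness, but averaging over `w` gives a law of `z` with
square-integrable density. Its second moment is at most the mean of `(5/3)^c` over two independent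
paths, `c` being their common length: a shared node contributes a factor `5/3`, any other node `1`.
As paths share `k` nodes with probability `2^(-k)` and `5/3 < 2`, the mean is bounded, by `3`
(`sum_commonLength_le`).

By Cauchy–Schwarz an open set `U` is hit by `z` with probability at most `√(3 λ(U))`
(`lebesgue_recodeSeq_le`). Since `z` is computed from `x` by `recode`, tests for `z` pull back to
tests for `x` (`MLRandom.recodeSeq`). -/

instance : IsProbabilityMeasure (lebesgue n) := by
  unfold lebesgue; infer_instance

theorem lebesgue_eqOn {ι : Type*} [Fintype ι] (e : ι → ℕ) (he : e.Injective) (c : ι → Fin n) :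
    lebesgue n {x | (fun i => x (e i)) = c} = ((n : ENNReal) ^ Fintype.card ι)⁻¹ := by
  classical
  have h : {x : InfSeq n | (fun i => x (e i)) = c} =
      Set.pi (Finset.univ.image e : Finset ℕ)
        (fun j => {a : Fin n | ∀ i, e i = j → a = c i}) := by
    ext x
    simp only [Set.mem_ofPred_eq, funext_iff, Set.mem_pi, Finset.coe_image, Finset.coe_univ,
      Set.image_univ, Set.mem_range]
    constructor
    · rintro h _ ⟨i, rfl⟩ i' hi'
      rw [← hi', h]
    · exact fun h i => h (e i) ⟨i, rfl⟩ i rfl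
  rw [h, lebesgue, Measure.infinitePi_pi _ (fun _ _ => MeasurableSet.of_discrete),
    Finset.prod_image (fun a _ b _ hab => he hab)]
  have h2 : ∀ i, {a : Fin n | ∀ i', e i' = e i → a = c i'} = {c i} := by
    intro i
    ext a
    simp only [Set.mem_ofPred_eq, Set.mem_singleton_iff]
    exact ⟨fun h => h i rfl, fun h i' hi' => by rw [h, he hi']⟩
  simp only [h2, PMF.toMeasure_apply_singleton _ _ (MeasurableSet.singleton _),
    PMF.uniformOfFintype_apply, Fintype.card_fin, Finset.prod_const, Finset.card_univ]
  rw [ENNReal.inv_pow]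

/-- Finitely many coordinates of a random sequence are uniformly distributed. -/
theorem lebesgue_marginal {ι : Type*} [Fintype ι] [DecidableEq ι] (e : ι → ℕ) (he : e.Injective)
    (S : Finset (ι → Fin n)) :
    lebesgue n {x | (fun i => x (e i)) ∈ S} = S.card * ((n : ENNReal) ^ Fintype.card ι)⁻¹ := by
  have h : {x : InfSeq n | (fun i => x (e i)) ∈ S} =
      ⋃ c ∈ S, {x | (fun i => x (e i)) = c} := by
    ext x; simp
  rw [h, measure_biUnion_finset]
  · simp [lebesgue_eqOn e he]
  · intro c _ d _ hcd
    refine Set.disjoint_left.2 fun x hx hx' => hcd ?_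
    exact (Set.mem_ofPred_eq ▸ hx).symm.trans hx'
  · intro c _
    have : Measurable (fun (x : InfSeq n) (i : ι) => x (e i)) :=
      measurable_pi_lambda _ fun i => measurable_pi_apply _
    exact this (measurableSet_singleton c)

end Marginals

section InitSeg

variable {n : ℕ}

@[simp] theorem length_initSeg (y : InfSeq n) (k : ℕ) : (initSeg y k).length = k := by
  simp [initSeg]

theorem initSeg_succ (y : InfSeq n) (k : ℕ) : initSeg y (k + 1) = initSeg y k ++ [y k] := by
  simp [initSeg, List.range_succ]

theorem getElem?_initSeg (y : InfSeq n) {k j : ℕ} (h : j < k) : (initSeg y k)[j]? = some (y j) := by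
  simp [initSeg, h]

theorem take_initSeg (y : InfSeq n) {k j : ℕ} (h : j ≤ k) :
    (initSeg y k).take j = initSeg y j := by
  simp [initSeg, ← List.map_take, List.take_range, h]

theorem initSeg_eq_ofFn (y : InfSeq n) (k : ℕ) :
    initSeg y k = List.ofFn fun i : Fin k => y i := by
  apply List.ext_getElem <;> simp [initSeg]

theorem mem_iUnion_cylinder {W : Set (List (Fin n))} {y : InfSeq n} :
    y ∈ ⋃ σ ∈ W, cylinder σ ↔ ∃ k, initSeg y k ∈ W := by
  simp only [Set.mem_iUnion, cylinder, Set.mem_ofPred_eq, exists_prop]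
  constructor
  · rintro ⟨σ, hσ, h⟩
    exact ⟨σ.length, h.symm ▸ hσ⟩
  · rintro ⟨k, hk⟩
    exact ⟨_, hk, by simp⟩

end InitSeg

/-! ### Almost every sequence is random -/

section Countable

theorem countable_setOf_rePred {α : Type*} [Primcodable α] : {p : α → Prop | REPred p}.Countable := by
  let f : Nat.Partrec.Code → α → Prop := fun c a => (c.eval (Encodable.encode a)).Dom
  refine (Set.countable_range f).mono fun p hp => ?_
  obtain ⟨c, hc⟩ := Nat.Partrec.Code.exists_code.1 hp
  refine ⟨c, funext fun a => ?_⟩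
  simp [f, hc, Part.assert]

theorem countable_setOf_isMLTest {n : ℕ} [NeZero n] :
    {U : ℕ → Set (InfSeq n) | IsMLTest U}.Countable := by
  have h := (countable_setOf_rePred (α := ℕ × List (Fin n))).image
    fun p i => ⋃ σ ∈ {σ | p (i, σ)}, cylinder σ
  refine h.mono fun U hU => ?_
  obtain ⟨W, hW, hUW⟩ := hU.sigma
  exact ⟨_, hW, funext fun i => (hUW i).symm⟩

/-- Almost every sequence is Martin-Löf random. -/
theorem ae_mlRandom {n : ℕ} [NeZero n] : ∀ᵐ x ∂lebesgue n, MLRandom x := by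
  have h : ∀ᵐ x ∂lebesgue n, ∀ U ∈ {U : ℕ → Set (InfSeq n) | IsMLTest U}, x ∉ ⋂ i, U i := by
    rw [ae_ball_iff countable_setOf_isMLTest]
    intro U hU
    rw [← measure_eq_zero_iff_ae_notMem, ← nonpos_iff_eq_zero]
    refine ge_of_tendsto' (ENNReal.tendsto_pow_atTop_nhds_zero_of_lt_one
      (by simp : (2⁻¹ : ENNReal) < 1)) fun i => ?_
    exact (measure_mono (Set.iInter_subset U i)).trans (IsMLTest.measure_le hU i)
  exact h

end Countable

/-! ### Counting: uniformity of the path and the second moment -/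

section Counting

/-- The output bit of a label; the label `2` gives no output. -/
def outBit (a : Fin 3) : Option (Fin 2) :=
  if a = 0 then some 0 else if a = 1 then some 1 else none

/-- The output is uniform: a given `w` appears with probability at most `2^(-|w|)`, with a deficit
because `L` labels may put out too few bits. In the induction the first label is the first bit of
`w`, or `2`, or a failure. -/
theorem card_prefix_filterMap_le (L : ℕ) (w : List (Fin 2)) :
    (∑ σ : Fin L → Fin 3, if w <+: (List.ofFn σ).filterMap outBit then 1 else 0) * 2 ^ w.length
      ≤ 3 ^ L := by
  induction L generalizing w with
  | zero =>
    cases w with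
    | nil => simp
    | cons b w => simp
  | succ L ih =>
    cases w with
    | nil => simp
    | cons b w =>
      have key : (∑ σ : Fin (L + 1) → Fin 3,
          if b :: w <+: (List.ofFn σ).filterMap outBit then 1 else 0) =
          (∑ σ : Fin L → Fin 3, if w <+: (List.ofFn σ).filterMap outBit then 1 else 0) +
          ∑ σ : Fin L → Fin 3, if b :: w <+: (List.ofFn σ).filterMap outBit then 1 else 0 := by
        rw [← (Fin.consEquiv fun _ => Fin 3).sum_comp, Fintype.sum_prod_type, Fin.sum_univ_three]
        fin_cases b <;>
          simp [Fin.consEquiv, List.ofFn_succ, outBit, List.cons_prefix_cons]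
      have h1 := ih w
      have h2 := ih (b :: w)
      rw [key, add_mul]
      simp only [List.length_cons, pow_succ] at h2 ⊢
      rw [← mul_assoc, ← mul_assoc] at *
      omega

/-- The length of the longest common prefix. -/
def commonLength : List (Fin 2) → List (Fin 2) → ℕ
  | a :: v, b :: w => if a = b then commonLength v w + 1 else 0
  | _, _ => 0

theorem length_le_commonLength {σ v w : List (Fin 2)} (hv : σ <+: v) (hw : σ <+: w) :
    σ.length ≤ commonLength v w := by
  induction σ generalizing v w with
  | nil => simp
  | cons a σ ih =>
    obtain ⟨v', rfl⟩ := hv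
    obtain ⟨w', rfl⟩ := hw
    simpa [commonLength] using ih (List.prefix_append σ v') (List.prefix_append σ w')

/-- Splitting on the first bits gives `s (N + 1) = 2 * (5/3) * s N + 2 * 4 ^ N`, and `3 * 4 ^ N`
satisfies this recursion. -/
theorem sum_commonLength_le (N : ℕ) :
    ∑ v : Fin N → Fin 2, ∑ w : Fin N → Fin 2,
      (5 / 3 : ℝ) ^ commonLength (List.ofFn v) (List.ofFn w) ≤ 3 * 4 ^ N := by
  induction N with
  | zero => simp [commonLength]
  | succ N ih =>
    rw [← (Fin.consEquiv fun _ => Fin 2).sum_comp]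
    simp_rw [← (Fin.consEquiv fun _ : Fin (N + 1) => Fin 2).sum_comp
      (fun w => (5 / 3 : ℝ) ^ commonLength _ (List.ofFn w))]
    simp only [Fintype.sum_prod_type, Fin.sum_univ_two, Fin.consEquiv, Equiv.coe_fn_mk,
      List.ofFn_succ, Fin.cons_zero, Fin.cons_succ, commonLength, if_true, Finset.sum_add_distrib,
      pow_succ, ← Finset.sum_mul]
    simp
    have : (2 : ℝ) ^ N * 2 ^ N = 4 ^ N := by rw [← mul_pow]; norm_num
    nlinarith

theorem stringIndex_concat (σ : List (Fin 2)) (b : Fin 2) :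
    stringIndex (σ ++ [b]) = 2 * stringIndex σ + 1 + b := by
  simp [stringIndex]

theorem length_le_stringIndex (σ : List (Fin 2)) : σ.length ≤ stringIndex σ := by
  induction σ using List.reverseRecOn with
  | nil => simp
  | append_singleton σ b ih => rw [stringIndex_concat]; simp; omega

theorem stringIndex_injective : stringIndex.Injective := by
  intro σ
  induction σ using List.reverseRecOn with
  | nil =>
    intro τ h
    have := length_le_stringIndex τ
    rw [← h] at this
    exact (List.eq_nil_of_length_eq_zero (by simpa [stringIndex] using this)).symm
  | append_singleton σ b ih =>
    intro τ h
    cases τ using List.reverseRecOn with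
    | nil => rw [stringIndex_concat] at h; simp [stringIndex] at h
    | append_singleton τ c =>
      rw [stringIndex_concat, stringIndex_concat] at h
      have hbc : b = c := by omega
      subst hbc
      rw [ih (by omega : stringIndex σ = stringIndex τ)]

/-- The string at position `n + 1` is a prefix of `w`. -/
def OnPath (w : List (Fin 2)) (n : ℕ) : Prop := ∃ k < n + 2, stringIndex (w.take k) = n + 1

instance (w : List (Fin 2)) (n : ℕ) : Decidable (OnPath w n) := by
  unfold OnPath; infer_instance

/-- Replace the label `a` at position `n` by `0` if it is `1` and the position lies on the
path `w`. -/
def editLabel (w : List (Fin 2)) (n : ℕ) (a : Fin 3) : Fin 3 :=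
  if OnPath w n ∧ a = 1 then 0 else a

theorem card_onPath_le (N : ℕ) (v w : List (Fin 2)) :
    ({n : Fin N | OnPath v n ∧ OnPath w n} : Finset (Fin N)).card ≤ commonLength v w := by
  have h : (({n : Fin N | OnPath v n ∧ OnPath w n} : Finset (Fin N)).image
      fun n : Fin N => (n : ℕ) + 1) ⊆
      (Finset.range (commonLength v w)).image fun j => stringIndex (v.take (j + 1)) := by
    intro m hm
    simp only [Finset.mem_image, Finset.mem_filter, Finset.mem_univ, true_and,
      Finset.mem_range] at hm ⊢
    obtain ⟨n, ⟨⟨k, -, hk⟩, ⟨l, -, hl⟩⟩, rfl⟩ := hm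
    have heq : v.take k = w.take l := stringIndex_injective (hk.trans hl.symm)
    have hlen := length_le_commonLength (List.take_prefix k v) (heq ▸ List.take_prefix l w)
    have hpos : 0 < (v.take k).length := by
      rw [List.length_pos_iff]
      intro h0
      rw [h0] at hk
      simp [stringIndex] at hk
    refine ⟨(v.take k).length - 1, by omega, ?_⟩
    rw [Nat.sub_add_cancel hpos, ← hk, List.length_take]
    congr 1
    rcases le_total k v.length with h | h
    · rw [min_eq_left h]
    · rw [min_eq_right h, List.take_of_length_le h, List.take_length]
  have h2 := Finset.card_le_card h
  rw [Finset.card_image_of_injective _ (fun a b hab => Fin.ext (by simpa using hab))] at h2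
  exact h2.trans (Finset.card_image_le.trans (by simp))

/-- On a path the labels `0, 1, 2` have weights `2, 0, 1`, elsewhere `1, 1, 1`. The inner product is
`5` if both paths pass through the node and `3` otherwise. -/
theorem sum_editLabel_eq (v w : List (Fin 2)) (n : ℕ) :
    ∑ c : Fin 3, (∑ a : Fin 3, if editLabel v n a = c then (1 : ℝ) else 0) *
      (∑ a : Fin 3, if editLabel w n a = c then (1 : ℝ) else 0) =
      3 * if OnPath v n ∧ OnPath w n then 5 / 3 else 1 := by
  by_cases hv : OnPath v n <;> by_cases hw : OnPath w n <;>
    simp only [editLabel, hv, hw, Fin.sum_univ_three, true_and, false_and, and_true, and_false,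
      if_true, if_false] <;> norm_num [Fin.ext_iff]

/-- The relabelling of a finite piece of the tree along `w`. -/
def editBlock {N : ℕ} (w : Fin N → Fin 2) (τ : Fin N → Fin 3) : Fin N → Fin 3 :=
  fun n => editLabel (List.ofFn w) n (τ n)

/-- The number of blocks that are relabelled to `ρ`. -/
theorem sum_editBlock_eq {N : ℕ} (w : Fin N → Fin 2) (ρ : Fin N → Fin 3) :
    (∑ τ : Fin N → Fin 3, if editBlock w τ = ρ then (1 : ℝ) else 0) =
      ∏ n : Fin N, ∑ a : Fin 3, if editLabel (List.ofFn w) n a = ρ n then (1 : ℝ) else 0 := by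
  rw [Fintype.prod_sum]
  refine Finset.sum_congr rfl fun τ _ => ?_
  rw [Finset.prod_ite_zero]
  simp [editBlock, funext_iff]

theorem sum_editBlock_mul_le {N : ℕ} (v w : Fin N → Fin 2) :
    ∑ ρ : Fin N → Fin 3, (∑ τ : Fin N → Fin 3, if editBlock v τ = ρ then (1 : ℝ) else 0) *
      (∑ τ : Fin N → Fin 3, if editBlock w τ = ρ then (1 : ℝ) else 0) ≤
      3 ^ N * (5 / 3 : ℝ) ^ commonLength (List.ofFn v) (List.ofFn w) := by
  simp_rw [sum_editBlock_eq, ← Finset.prod_mul_distrib]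
  rw [← Fintype.prod_sum (fun (n : Fin N) (c : Fin 3) =>
    (∑ a : Fin 3, if editLabel (List.ofFn v) n a = c then (1 : ℝ) else 0) *
      (∑ a : Fin 3, if editLabel (List.ofFn w) n a = c then (1 : ℝ) else 0))]
  simp_rw [sum_editLabel_eq, Finset.prod_mul_distrib, Finset.prod_ite]
  simp only [Finset.prod_const, Finset.card_univ, Fintype.card_fin, one_pow, mul_one]
  gcongr
  · norm_num
  · exact card_onPath_le N _ _

theorem sq_card_editBlock_le {N : ℕ} (S : Finset (Fin N → Fin 3)) :
    (∑ w : Fin N → Fin 2, ∑ τ : Fin N → Fin 3, if editBlock w τ ∈ S then (1 : ℝ) else 0) ^ 2 ≤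
      3 * S.card * 3 ^ N * 4 ^ N := by
  set D : (Fin N → Fin 2) → (Fin N → Fin 3) → ℝ := fun w ρ =>
    ∑ τ : Fin N → Fin 3, if editBlock w τ = ρ then (1 : ℝ) else 0 with hD
  have h1 : (∑ w : Fin N → Fin 2, ∑ τ : Fin N → Fin 3, if editBlock w τ ∈ S then (1 : ℝ) else 0) =
      ∑ ρ ∈ S, ∑ w, D w ρ := by
    rw [Finset.sum_comm (s := S)]
    refine Finset.sum_congr rfl fun w _ => ?_
    simp only [hD]
    rw [Finset.sum_comm]
    refine Finset.sum_congr rfl fun τ _ => ?_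
    simp
  -- Cauchy–Schwarz on `S`; expanding the square then produces pairs of paths.
  have h2 : (∑ ρ ∈ S, ∑ w, D w ρ) ^ 2 ≤ S.card * ∑ ρ ∈ S, (∑ w, D w ρ) ^ 2 :=
    sq_sum_le_card_mul_sum_sq
  have h3 : ∑ ρ ∈ S, (∑ w, D w ρ) ^ 2 ≤ ∑ ρ, (∑ w, D w ρ) ^ 2 :=
    Finset.sum_le_sum_of_subset_of_nonneg (Finset.subset_univ _) fun _ _ _ => sq_nonneg _
  have h4 : ∑ ρ, (∑ w, D w ρ) ^ 2 = ∑ v, ∑ w, ∑ ρ, D v ρ * D w ρ := by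
    simp_rw [sq, Finset.sum_mul_sum]
    rw [Finset.sum_comm]
    refine Finset.sum_congr rfl fun v _ => Finset.sum_comm
  have h5 : ∑ v, ∑ w, ∑ ρ, D v ρ * D w ρ ≤ 3 ^ N * (3 * 4 ^ N) := by
    refine le_trans (Finset.sum_le_sum fun v _ => Finset.sum_le_sum fun w _ =>
      sum_editBlock_mul_le v w) ?_
    simp_rw [← Finset.mul_sum]
    exact mul_le_mul_of_nonneg_left (sum_commonLength_le N) (by positivity)
  rw [h1]
  refine h2.trans ?_
  have h6 := mul_le_mul_of_nonneg_left (h3.trans (h4.le.trans h5)) (Nat.cast_nonneg (α := ℝ) S.card)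
  refine h6.trans (le_of_eq ?_)
  ring

end Counting

/-! ### The second moment bound as a statement about measure -/

section SecondMoment

/-- The positions of the labels of the strings `0, 00, 000, …`. -/
def zeroPos (k : ℕ) : ℕ := 2 ^ (k + 1) - 2

theorem zeroPos_add_two (k : ℕ) : zeroPos k + 2 = 2 ^ (k + 1) := by
  have : 2 ^ 1 ≤ 2 ^ (k + 1) := Nat.pow_le_pow_right (by norm_num) (by omega)
  unfold zeroPos
  omega

theorem zeroPos_strictMono : StrictMono zeroPos := by
  refine strictMono_nat_of_lt_succ fun k => ?_
  have h1 := zeroPos_add_two k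
  have h2 := zeroPos_add_two (k + 1)
  rw [pow_succ] at h2
  omega

/-- This makes the path independent of the labels that are edited along it. -/
theorem zeroPos_ne_odd (k n : ℕ) : zeroPos k ≠ 2 * n + 1 := by
  have h := zeroPos_add_two k
  rw [pow_succ] at h
  omega

theorem stringIndex_initSeg_zero (k : ℕ) : stringIndex (initSeg (fun _ => 0) k) + 1 = 2 ^ k := by
  induction k with
  | zero => simp [initSeg, stringIndex]
  | succ k ih =>
    rw [initSeg_succ, stringIndex_concat, pow_succ]
    simp
    omega

theorem label_initSeg_zero (x : InfSeq 3) (k : ℕ) :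
    label x (initSeg (fun _ => 0) (k + 1)) = x (zeroPos k) := by
  have h := stringIndex_initSeg_zero (k + 1)
  unfold label zeroPos
  congr 1
  omega

/-- The bits that the labels of the strings `0, …, 0 ^ L` put out. -/
def zeroOutput (x : InfSeq 3) (L : ℕ) : List (Fin 2) :=
  (List.ofFn fun k : Fin L => x (zeroPos k)).filterMap outBit

theorem card_sum_arrow_le {L N : ℕ} (S : Finset (Fin N → Fin 3))
    (T : Finset (Fin L ⊕ Fin N → Fin 3))
    (hT : ∀ f ∈ T, ∃ w : Fin N → Fin 2,
      List.ofFn w <+: (List.ofFn fun k => f (Sum.inl k)).filterMap outBit ∧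
        editBlock w (fun n => f (Sum.inr n)) ∈ S) :
    T.card ^ 2 ≤ (3 ^ L) ^ 2 * (3 * S.card * 3 ^ N) := by
  set A : (Fin N → Fin 2) → ℕ := fun w =>
    ∑ σ : Fin L → Fin 3, if List.ofFn w <+: (List.ofFn σ).filterMap outBit then 1 else 0 with hA
  set B : (Fin N → Fin 2) → ℕ := fun w =>
    ∑ τ : Fin N → Fin 3, if editBlock w τ ∈ S then 1 else 0 with hB
  have h1 : T.card ≤ ∑ w, A w * B w := by
    calc T.card = ∑ f ∈ T, 1 := by simp
      _ ≤ ∑ f ∈ T, ∑ w : Fin N → Fin 2,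
          (if List.ofFn w <+: (List.ofFn fun k => f (Sum.inl k)).filterMap outBit then 1 else 0) *
          (if editBlock w (fun n => f (Sum.inr n)) ∈ S then 1 else 0) := by
        refine Finset.sum_le_sum fun f hf => ?_
        obtain ⟨w, hw, hw'⟩ := hT f hf
        refine le_trans ?_ (Finset.single_le_sum (fun _ _ => Nat.zero_le _) (Finset.mem_univ w))
        rw [if_pos hw, if_pos hw']
      _ ≤ ∑ f : Fin L ⊕ Fin N → Fin 3, ∑ w : Fin N → Fin 2,
          (if List.ofFn w <+: (List.ofFn fun k => f (Sum.inl k)).filterMap outBit then 1 else 0) *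
          (if editBlock w (fun n => f (Sum.inr n)) ∈ S then 1 else 0) :=
        Finset.sum_le_sum_of_subset (Finset.subset_univ _)
      _ = ∑ w, A w * B w := by
        rw [Finset.sum_comm]
        refine Finset.sum_congr rfl fun w _ => ?_
        rw [← (Equiv.sumArrowEquivProdArrow (Fin L) (Fin N) (Fin 3)).symm.sum_comp,
          Fintype.sum_prod_type, hA, hB, Finset.sum_mul_sum]
        rfl
  have h2 : T.card * 2 ^ N ≤ 3 ^ L * ∑ w, B w := by
    refine (Nat.mul_le_mul_right _ h1).trans ?_
    rw [Finset.sum_mul, Finset.mul_sum]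
    refine Finset.sum_le_sum fun w _ => ?_
    have := card_prefix_filterMap_le L (List.ofFn w)
    rw [List.length_ofFn] at this
    calc A w * B w * 2 ^ N = A w * 2 ^ N * B w := by ring
      _ ≤ 3 ^ L * B w := Nat.mul_le_mul_right _ this
  have h3 : (∑ w, B w) ^ 2 ≤ 3 * S.card * 3 ^ N * 4 ^ N := by
    have := sq_card_editBlock_le S
    simp only [hB]
    exact_mod_cast this
  have h4 : (T.card * 2 ^ N) ^ 2 ≤ (3 ^ L * ∑ w, B w) ^ 2 := Nat.pow_le_pow_left h2 2
  have h5 : T.card ^ 2 * 4 ^ N ≤ (3 ^ L) ^ 2 * (3 * S.card * 3 ^ N) * 4 ^ N := by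
    calc T.card ^ 2 * 4 ^ N = (T.card * 2 ^ N) ^ 2 := by
          rw [mul_pow, ← pow_mul, mul_comm N 2, pow_mul]; norm_num
      _ ≤ (3 ^ L * ∑ w, B w) ^ 2 := h4
      _ = (3 ^ L) ^ 2 * (∑ w, B w) ^ 2 := by ring
      _ ≤ (3 ^ L) ^ 2 * (3 * S.card * 3 ^ N * 4 ^ N) := Nat.mul_le_mul_left _ h3
      _ = _ := by ring
  exact Nat.le_of_mul_le_mul_right h5 (by positivity)

theorem sq_lebesgue_editBlock_le (L N : ℕ) (S : Finset (Fin N → Fin 3)) :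
    lebesgue 3 {x | ∃ w : Fin N → Fin 2, List.ofFn w <+: zeroOutput x L ∧
        editBlock w (fun n => x (2 * n + 1)) ∈ S} ^ 2 ≤
      3 * lebesgue 3 {z | (fun n : Fin N => z n) ∈ S} := by
  classical
  let e : Fin L ⊕ Fin N → ℕ := Sum.elim (fun k => zeroPos k) fun n => 2 * n + 1
  have he : e.Injective := by
    rintro (k | k) (l | l) h
    · exact congrArg Sum.inl (Fin.ext (zeroPos_strictMono.injective h))
    · exact absurd h (zeroPos_ne_odd _ _)
    · exact absurd h.symm (zeroPos_ne_odd _ _)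
    · simp only [e, Sum.elim_inr] at h
      exact congrArg Sum.inr (Fin.ext (by omega))
  let T : Finset (Fin L ⊕ Fin N → Fin 3) := Finset.univ.filter fun f => ∃ w : Fin N → Fin 2,
      List.ofFn w <+: (List.ofFn fun k => f (Sum.inl k)).filterMap outBit ∧
        editBlock w (fun n => f (Sum.inr n)) ∈ S
  have hT := card_sum_arrow_le S T fun f hf => (Finset.mem_filter.1 hf).2
  have h1 : {x : InfSeq 3 | ∃ w : Fin N → Fin 2, List.ofFn w <+: zeroOutput x L ∧
        editBlock w (fun n => x (2 * n + 1)) ∈ S} = {x | (fun i => x (e i)) ∈ T} := by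
    ext x
    simp [T, zeroOutput, e]
  rw [h1, lebesgue_marginal e he, lebesgue_marginal (fun n : Fin N => (n : ℕ)) Fin.val_injective]
  simp only [Fintype.card_sum, Fintype.card_fin]
  rw [← div_eq_mul_inv, ← div_eq_mul_inv, div_eq_mul_inv, mul_pow, ← ENNReal.inv_pow,
    ← div_eq_mul_inv, ← mul_div_assoc]
  refine ENNReal.div_le_of_le_mul ?_
  have h3 : ((3 : ENNReal) ^ N) ≠ 0 := by simp
  have h3' : ((3 : ENNReal) ^ N) ≠ ⊤ := by simp
  calc (T.card : ENNReal) ^ 2 ≤ ((3 : ENNReal) ^ L) ^ 2 * (3 * (S.card : ENNReal) * 3 ^ N) := by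
        exact_mod_cast hT
    _ = 3 * (S.card : ENNReal) / 3 ^ N * 3 ^ N * ((3 ^ L) ^ 2 * 3 ^ N) := by
      rw [ENNReal.div_mul_cancel h3 h3']; ring
    _ = _ := by push_cast; ring

end SecondMoment

/-! ### Random codes along the zero path -/

section ZeroPath

theorem primrec_zeroPos : Primrec zeroPos :=
  Primrec.nat_sub.comp ((Primrec₂.unpaired'.1 Nat.Primrec.pow).comp (Primrec.const 2)
    Primrec.succ) (Primrec.const 2)

/-- A random code gives infinitely many of the strings `0, 00, 000, …` the label `1`. -/
theorem MLRandom.exists_zeroPos_eq_one {u : InfSeq 3} (hu : MLRandom u) (K : ℕ) :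
    ∃ k ≥ K, u (zeroPos k) = 1 := by
  by_contra! hne
  let W : ℕ → Set (List (Fin 3)) := fun i =>
    -- The default `1` excludes strings too short to decide the condition. Using `2 * i` positions
    -- gives measure `(4/9)^i ≤ 2^(-i)`.
    {σ | ∀ k < 2 * i, σ.getD (zeroPos (K + k)) 1 ≠ 1}
  let U : ℕ → Set (InfSeq 3) := fun i => {y | ∀ k < 2 * i, y (zeroPos (K + k)) ≠ 1}
  have hU : ∀ i, U i = ⋃ σ ∈ W i, cylinder σ := by
    intro i
    ext y
    rw [mem_iUnion_cylinder]
    constructor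
    · intro hy
      refine ⟨zeroPos (K + 2 * i), fun k hk => ?_⟩
      rw [List.getD_eq_getElem?_getD, getElem?_initSeg _ (zeroPos_strictMono (by omega))]
      exact hy k hk
    · rintro ⟨N, hN⟩ k hk
      have := hN k hk
      rw [List.getD_eq_getElem?_getD] at this
      rcases lt_or_ge (zeroPos (K + k)) N with h | h
      · rwa [getElem?_initSeg _ h] at this
      · rw [List.getElem?_eq_none (by simpa using h)] at this
        exact absurd rfl this
  have hre : REPred (fun p : ℕ × List (Fin 3) => p.2 ∈ W p.1) := by
    have h1 : PrimrecRel fun (k : ℕ) (σ : List (Fin 3)) => σ.getD (zeroPos (K + k)) 1 ≠ 1 :=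
      (Primrec.eq.comp ((Primrec.list_getD 1).comp Primrec.snd
        (primrec_zeroPos.comp (Primrec.nat_add.comp (Primrec.const K) Primrec.fst))) (Primrec.const 1)).not
    have h2 : PrimrecPred fun p : ℕ × List (Fin 3) => p.2 ∈ W p.1 :=
      (h1.forall_mem_list.comp (Primrec.list_range.comp
        (Primrec.nat_mul.comp (Primrec.const 2) Primrec.fst)) Primrec.snd).of_eq
        fun p => by simp [W]
    exact ComputablePred.to_re h2.computablePred
  have hmeas : ∀ i, lebesgue 3 (U i) ≤ (2⁻¹ : ENNReal) ^ i := by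
    intro i
    let S : Finset (Fin (2 * i) → Fin 3) := Fintype.piFinset fun _ => {0, 2}
    have hS : U i = {y | (fun k : Fin (2 * i) => y (zeroPos (K + k))) ∈ S} := by
      ext y
      simp only [U, S, Set.mem_ofPred_eq, Fintype.mem_piFinset, Finset.mem_insert,
        Finset.mem_singleton]
      constructor
      · intro h k
        have := h k k.2
        omega
      · intro h k hk
        have := h ⟨k, hk⟩
        simp only at this
        omega
    rw [hS, lebesgue_marginal _ fun a b hab => by
      have := zeroPos_strictMono.injective hab
      exact Fin.ext (by omega)]
    have hc : S.card = 4 ^ i := by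
      simp [S, Fintype.card_piFinset, pow_mul]
    rw [hc, Fintype.card_fin, pow_mul, ← div_eq_mul_inv]
    refine ENNReal.div_le_of_le_mul ?_
    push_cast
    rw [← mul_pow]
    refine pow_le_pow_left' ?_ i
    rw [← ENNReal.toReal_le_toReal (by simp) (ENNReal.mul_ne_top (by simp) (by simp))]
    norm_num
  exact hu U ⟨⟨W, hre, hU⟩, hmeas⟩ (Set.mem_iInter.2 fun i k _ => hne _ (Nat.le_add_right K k))

theorem MLRandom.infinite_zeroPos {u : InfSeq 3} (hu : MLRandom u) :
    {k | u (zeroPos k) ≠ 2}.Infinite := by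
  refine Set.infinite_of_not_bddAbove fun ⟨b, hb⟩ => ?_
  obtain ⟨k, hk, h1⟩ := hu.exists_zeroPos_eq_one (b + 1)
  have := hb (show u (zeroPos k) ≠ 2 by rw [h1]; decide)
  omega

end ZeroPath

/-! ### The recoded sequence and its finite approximations -/

section Recode

/-- `w` is the infinite output along `0, 00, 000, …` of the labelling `x`. -/
structure IsZeroOutput (x : InfSeq 3) (w : InfSeq 2) : Prop where
  eq_initSeg : ∀ L, zeroOutput x L = initSeg w (zeroOutput x L).length
  unbounded : ∀ m, ∃ L, m ≤ (zeroOutput x L).length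

theorem zeroOutput_succ (x : InfSeq 3) (L : ℕ) :
    zeroOutput x (L + 1) = zeroOutput x L ++ (outBit (x (zeroPos L))).toList := by
  have h : ∀ M, zeroOutput x M = (initSeg (fun k => x (zeroPos k)) M).filterMap outBit := by
    intro M; rw [initSeg_eq_ofFn]; rfl
  rw [h, h, initSeg_succ, List.filterMap_append]
  cases hb : outBit (x (zeroPos L)) <;> simp [hb]

theorem zeroOutput_mono (x : InfSeq 3) {L M : ℕ} (h : L ≤ M) :
    zeroOutput x L <+: zeroOutput x M := by
  induction M, h using Nat.le_induction with
  | base => exact List.prefix_refl _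
  | succ M _ ih => exact ih.trans (zeroOutput_succ x M ▸ List.prefix_append _ _)

theorem outBit_of_ne_two {a : Fin 3} (h : a ≠ 2) : outBit a = some (a.castLT (by omega)) := by
  revert a; decide

theorem codedFun_zero (x : InfSeq 3) :
    codedFun x (fun _ => 0) = eraseTwos fun k => x (zeroPos k) := by
  simp only [codedFun, label_initSeg_zero]

theorem exists_isZeroOutput {x : InfSeq 3} (hx : {k | x (zeroPos k) ≠ 2}.Infinite) :
    ∃ w, codedFun x (fun _ => 0) = Part.some w ∧ IsZeroOutput x w := by
  have hdom : (eraseTwos fun k => x (zeroPos k)).Dom := hx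
  refine ⟨(eraseTwos fun k => x (zeroPos k)).get hdom, ?_, ?_⟩
  · rw [codedFun_zero]; exact (Part.some_get hdom).symm
  set w := (eraseTwos fun k => x (zeroPos k)).get hdom with hw
  have key : ∀ L, zeroOutput x L = initSeg w (Nat.count (fun k => x (zeroPos k) ≠ 2) L) := by
    intro L
    induction L with
    | zero => simp [zeroOutput, initSeg]
    | succ L ih =>
      rw [zeroOutput_succ, Nat.count_succ, ih]
      by_cases h : x (zeroPos L) = 2
      · simp [h, outBit]
      · rw [if_pos h, initSeg_succ, outBit_of_ne_two h]
        congr 2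
        simp only [hw, eraseTwos, Nat.nth_count (p := fun k => x (zeroPos k) ≠ 2) h,
          Option.toList_some]
  refine ⟨fun L => ?_, fun m => ?_⟩
  · rw [key L, length_initSeg]
  · refine ⟨Nat.nth (fun k => x (zeroPos k) ≠ 2) m, ?_⟩
    rw [key, length_initSeg, Nat.count_nth_of_infinite hx]

/-- Use the odd entries of `x` as labels, with `1` replaced by `0` along `w`. -/
def recodeSeq (w : InfSeq 2) (x : InfSeq 3) : InfSeq 3 :=
  fun n => editLabel (initSeg w (n + 1)) n (x (2 * n + 1))

/-- `OnPath` at `n` inspects only prefixes of length at most `n + 1`, so longer segments of `w` give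
the same edit. -/
theorem editLabel_initSeg (w : InfSeq 2) {n m : ℕ} (h : n < m) (a : Fin 3) :
    editLabel (initSeg w m) n a = editLabel (initSeg w (n + 1)) n a := by
  have : OnPath (initSeg w m) n ↔ OnPath (initSeg w (n + 1)) n := by
    unfold OnPath
    refine exists_congr fun k => and_congr_right fun hk => ?_
    rw [take_initSeg _ (by omega), take_initSeg _ (by omega)]
  simp only [editLabel, this]

theorem label_recodeSeq_ne_one (w : InfSeq 2) (x : InfSeq 3) (k : ℕ) :
    label (recodeSeq w x) (initSeg w (k + 1)) ≠ 1 := by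
  obtain ⟨n, hn⟩ : ∃ n, stringIndex (initSeg w (k + 1)) = n + 1 :=
    ⟨stringIndex (initSeg w k) * 2 + (w k : ℕ), by rw [initSeg_succ, stringIndex_concat]; ring⟩
  have hle := length_le_stringIndex (initSeg w (k + 1))
  rw [length_initSeg, hn] at hle
  have hon : OnPath (initSeg w (n + 1)) n :=
    ⟨k + 1, by omega, by rw [take_initSeg _ hle, hn]⟩
  rw [label, hn, Nat.add_sub_cancel, recodeSeq, editLabel]
  simp only [hon, true_and]
  split_ifs with h
  · decide
  · exact h

/-- The output along `0, 00, 000, …` that is determined by the finite string `η`. -/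
def outputAlong (η : List (Fin 3)) : List (Fin 2) :=
  (List.range η.length).filterMap fun k => (η[zeroPos k]?).bind outBit

/-- An initial segment of the relabelled sequence that is determined by `η`. Its length is
bounded by the first component of `η.length`, so that every length occurs. -/
def recode (η : List (Fin 3)) : List (Fin 3) :=
  (List.range (min η.length.unpair.1 (min (outputAlong η).length (η.length / 2)))).map
    fun n => editLabel (outputAlong η) n (η.getD (2 * n + 1) 0)

theorem exists_outputAlong_eq (x : InfSeq 3) (N : ℕ) :
    ∃ L, outputAlong (initSeg x N) = zeroOutput x L ∧ ∀ L', zeroPos L' < N → L' ≤ L := by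
  have key : ∀ M, ∃ L ≤ M, ((List.range M).filterMap fun k =>
      ((initSeg x N)[zeroPos k]?).bind outBit) = zeroOutput x L ∧ (L = M ∨ N ≤ zeroPos L) := by
    intro M
    induction M with
    | zero => exact ⟨0, le_rfl, by simp [zeroOutput], Or.inl rfl⟩
    | succ M ih =>
      obtain ⟨L, hLM, hL, h⟩ := ih
      rw [List.range_succ, List.filterMap_append, hL]
      rcases lt_or_ge (zeroPos M) N with hM | hM
      · have hLM' : L = M := h.resolve_right fun h' => by
          have := zeroPos_strictMono.monotone hLM
          omega
        subst hLM'
        refine ⟨L + 1, le_rfl, ?_, Or.inl rfl⟩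
        rw [zeroOutput_succ, List.filterMap_cons, getElem?_initSeg _ hM]
        cases hb : outBit (x (zeroPos L)) <;> simp [hb]
      · refine ⟨L, by omega, ?_, Or.inr ?_⟩
        · simp [List.getElem?_eq_none (show (initSeg x N).length ≤ zeroPos M by simpa using hM)]
        · rcases h with rfl | h
          · exact hM
          · exact h
  obtain ⟨L, -, hL, h⟩ := key N
  refine ⟨L, by rw [outputAlong, length_initSeg, hL], fun L' hL' => ?_⟩
  rcases h with rfl | h
  · exact zeroPos_strictMono.le_apply.trans hL'.le
  · exact (zeroPos_strictMono.lt_iff_lt.1 (hL'.trans_le h)).le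

theorem IsZeroOutput.recode_initSeg {x : InfSeq 3} {w : InfSeq 2} (h : IsZeroOutput x w) (N : ℕ) :
    recode (initSeg x N) = initSeg (recodeSeq w x)
      (min N.unpair.1 (min (outputAlong (initSeg x N)).length (N / 2))) := by
  obtain ⟨L, hL, -⟩ := exists_outputAlong_eq x N
  rw [recode, length_initSeg]
  refine List.map_congr_left fun n hn => ?_
  rw [List.mem_range, lt_min_iff, lt_min_iff] at hn
  rw [recodeSeq, List.getD_eq_getElem?_getD, getElem?_initSeg _ (by omega), hL, h.eq_initSeg L,
    editLabel_initSeg _ (by rw [← hL]; exact hn.2.1)]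
  rfl

theorem IsZeroOutput.exists_recode_eq {x : InfSeq 3} {w : InfSeq 2} (h : IsZeroOutput x w)
    (m : ℕ) : ∃ N, recode (initSeg x N) = initSeg (recodeSeq w x) m := by
  obtain ⟨L, hL⟩ := h.unbounded m
  -- The first component fixes the length `m`; the second makes `N` large enough that the other two
  -- bounds in `recode` are at least `m`.
  let N := Nat.pair m (zeroPos L + 1 + 2 * m)
  have hN : zeroPos L + 1 + 2 * m ≤ N := Nat.right_le_pair _ _
  obtain ⟨L', hL', hle⟩ := exists_outputAlong_eq x N
  have hlen : m ≤ (outputAlong (initSeg x N)).length := by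
    rw [hL']
    exact hL.trans (zeroOutput_mono x (hle L (by omega))).length_le
  refine ⟨N, ?_⟩
  rw [h.recode_initSeg]
  congr 1
  have : N.unpair.1 = m := by simp [N]
  omega

end Recode

/-! ### Computability of the recoding -/

section Computability

theorem primrec_stringIndex : Primrec stringIndex :=
  (Primrec.list_foldl Primrec.id (Primrec.const 0)
    (Primrec.nat_add.comp (Primrec.succ.comp (Primrec.nat_mul.comp (Primrec.const 2)
      (Primrec.fst.comp Primrec.snd))) (Primrec.fin_val.comp (Primrec.snd.comp Primrec.snd))).to₂).of_eq
    fun σ => by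
      induction σ using List.reverseRecOn with
      | nil => rfl
      | append_singleton σ b ih => simp_all [stringIndex_concat]

theorem primrecPred_onPath : PrimrecPred fun p : List (Fin 2) × ℕ => OnPath p.1 p.2 := by
  have h : PrimrecRel fun (k : ℕ) (p : List (Fin 2) × ℕ) =>
      stringIndex (p.1.take k) = p.2 + 1 :=
    Primrec.eq.comp (primrec_stringIndex.comp (Primrec.list_take.comp Primrec.fst
      (Primrec.fst.comp Primrec.snd))) (Primrec.succ.comp (Primrec.snd.comp Primrec.snd))
  exact (h.exists_mem_list.comp (Primrec.list_range.comp
    (Primrec.nat_add.comp Primrec.snd (Primrec.const 2))) Primrec.id).of_eq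
    fun p => by simp [OnPath]

theorem primrec_outputAlong : Primrec outputAlong :=
  Primrec.listFilterMap (Primrec.list_range.comp Primrec.list_length)
    (Primrec.option_bind (Primrec.list_getElem?.comp Primrec.fst
      (primrec_zeroPos.comp Primrec.snd)) ((Primrec.dom_finite outBit).comp Primrec.snd).to₂).to₂

theorem primrec_recode : Primrec recode := by
  refine Primrec.list_map (Primrec.list_range.comp (Primrec.nat_min.comp
    (Primrec.fst.comp (Primrec.unpair.comp Primrec.list_length)) (Primrec.nat_min.comp
      (Primrec.list_length.comp primrec_outputAlong)
      (Primrec.nat_div.comp Primrec.list_length (Primrec.const 2))))) ?_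
  have hlab : Primrec fun p : List (Fin 3) × ℕ => p.1.getD (2 * p.2 + 1) 0 :=
    (Primrec.list_getD 0).comp Primrec.fst
      (Primrec.succ.comp (Primrec.nat_mul.comp (Primrec.const 2) Primrec.snd))
  exact Primrec.ite ((primrecPred_onPath.comp
    ((primrec_outputAlong.comp Primrec.fst).pair Primrec.snd)).and
      (Primrec.eq.comp hlab (Primrec.const 1))) (Primrec.const 0) hlab

theorem REPred.comp {α β : Type*} [Primcodable α] [Primcodable β] {p : β → Prop} (hp : REPred p)
    {f : α → β} (hf : Computable f) : REPred fun a => p (f a) :=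
  Partrec.comp hp hf

end Computability

/-! ### The recoding preserves randomness -/

section Preservation

theorem lebesgue_recodeSeq_le (W : Set (List (Fin 3))) (b : ENNReal)
    (hb : 3 * lebesgue 3 (⋃ σ ∈ W, cylinder σ) ≤ b ^ 2) :
    lebesgue 3 {x | ∃ w, IsZeroOutput x w ∧ recodeSeq w x ∈ ⋃ σ ∈ W, cylinder σ} ≤ b := by
  classical
  let S : ∀ N : ℕ, Finset (Fin N → Fin 3) := fun N =>
    Finset.univ.filter fun ρ => ∃ m ≤ N, (List.ofFn ρ).take m ∈ W
  let Q : ℕ → ℕ → Set (InfSeq 3) := fun N L =>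
    {x | ∃ w : Fin N → Fin 2, List.ofFn w <+: zeroOutput x L ∧
        editBlock w (fun n => x (2 * n + 1)) ∈ S N}
  have hS : ∀ N (z : InfSeq 3), (fun n : Fin N => z n) ∈ S N ↔ ∃ m ≤ N, initSeg z m ∈ W := by
    intro N z
    simp only [S, Finset.mem_filter, Finset.mem_univ, true_and, ← initSeg_eq_ofFn]
    refine exists_congr fun m => and_congr_right fun hm => ?_
    rw [take_initSeg z hm]
  have hQ : ∀ N L, lebesgue 3 (Q N L) ≤ b := by
    intro N L
    refine (ENNReal.pow_le_pow_left_iff two_ne_zero).1 ?_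
    refine (sq_lebesgue_editBlock_le L N (S N)).trans (le_trans ?_ hb)
    gcongr
    intro z hz
    obtain ⟨m, -, hm⟩ := (hS N z).1 hz
    exact mem_iUnion_cylinder.2 ⟨m, hm⟩
  let E : ℕ → Set (InfSeq 3) := fun N =>
    {x | ∃ w, IsZeroOutput x w ∧ ∃ m ≤ N, initSeg (recodeSeq w x) m ∈ W}
  have hE : ∀ N, lebesgue 3 (E N) ≤ b := by
    intro N
    have hsub : E N ⊆ ⋃ L, Q N L := by
      rintro x ⟨w, hw, hm⟩
      obtain ⟨L, hL⟩ := hw.unbounded N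
      refine Set.mem_iUnion.2 ⟨L, fun n => w n, ?_, ?_⟩
      · rw [← initSeg_eq_ofFn, hw.eq_initSeg L, ← take_initSeg w hL]
        exact List.take_prefix _ _
      · have : editBlock (fun n : Fin N => w n) (fun n => x (2 * n + 1)) =
            fun n : Fin N => recodeSeq w x n := by
          funext n
          rw [editBlock, ← initSeg_eq_ofFn, editLabel_initSeg w n.2, recodeSeq]
        rw [this]
        exact (hS N _).2 hm
    refine (measure_mono hsub).trans ?_
    have hmono : Monotone (Q N) := by
      rintro L M hLM x ⟨w, hw, hw'⟩
      exact ⟨w, hw.trans (zeroOutput_mono x hLM), hw'⟩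
    -- The bound is uniform in `L`, so continuity from below removes the truncation; the same is
    -- done for `N` below.
    rw [hmono.measure_iUnion]
    exact iSup_le (hQ N)
  have hsub : {x | ∃ w, IsZeroOutput x w ∧ recodeSeq w x ∈ ⋃ σ ∈ W, cylinder σ} ⊆ ⋃ N, E N := by
    rintro x ⟨w, hw, hz⟩
    obtain ⟨m, hm⟩ := mem_iUnion_cylinder.1 hz
    exact Set.mem_iUnion.2 ⟨m, w, hw, m, le_rfl, hm⟩
  refine (measure_mono hsub).trans ?_
  have hmono : Monotone E := by
    rintro M N hMN x ⟨w, hw, m, hm, hm'⟩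
    exact ⟨w, hw, m, hm.trans hMN, hm'⟩
  rw [hmono.measure_iUnion]
  exact iSup_le hE

theorem three_mul_inv_two_pow_le (i : ℕ) :
    3 * (2⁻¹ : ENNReal) ^ (2 * i + 2) ≤ ((2⁻¹ : ENNReal) ^ i) ^ 2 := by
  rw [pow_add, mul_comm 2 i, pow_mul, mul_left_comm]
  refine mul_le_of_le_one_right' ?_
  rw [← ENNReal.toReal_le_toReal (ENNReal.mul_ne_top (by simp) (by simp)) (by simp)]
  norm_num

theorem MLRandom.recodeSeq {x : InfSeq 3} (hx : MLRandom x) {w : InfSeq 2}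
    (hw : IsZeroOutput x w) : MLRandom (recodeSeq w x) := by
  intro U hU hmem
  obtain ⟨W, hW, hUW⟩ := hU.sigma
  -- The index `2 * i + 2` absorbs the square root and the constant: `3 * 2^(-(2i+2)) ≤ (2^(-i))^2`.
  let W' : ℕ → Set (List (Fin 3)) := fun i => {η | recode η ∈ W (2 * i + 2)}
  refine hx (fun i => ⋃ σ ∈ W' i, cylinder σ) ⟨⟨W', ?_, fun _ => rfl⟩, fun i => ?_⟩ ?_
  · exact REPred.comp hW (f := fun p : ℕ × List (Fin 3) => (2 * p.1 + 2, recode p.2))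
      ((Primrec.nat_add.comp (Primrec.nat_mul.comp (Primrec.const 2) Primrec.fst)
        (Primrec.const 2)).pair (primrec_recode.comp Primrec.snd)).to_comp
  · refine le_trans ?_ (lebesgue_recodeSeq_le (W (2 * i + 2)) _ ?_)
    -- A sequence without infinite zero output may also lie in the pulled-back set, but such
    -- sequences form a null set.
    · refine measure_mono_ae ?_
      filter_upwards [ae_mlRandom] with y hy hyV
      obtain ⟨v, -, hv⟩ := exists_isZeroOutput hy.infinite_zeroPos
      obtain ⟨N, hN⟩ := mem_iUnion_cylinder.1 hyV
      have hN' : recode (initSeg y N) ∈ W (2 * i + 2) := hN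
      rw [hv.recode_initSeg N] at hN'
      exact ⟨v, hv, mem_iUnion_cylinder.2 ⟨_, hN'⟩⟩
    · rw [← hUW]
      exact le_trans (by gcongr; exact hU.measure_le _) (three_mul_inv_two_pow_le i)
  · refine Set.mem_iInter.2 fun i => mem_iUnion_cylinder.2 ?_
    have h := Set.mem_iInter.1 hmem (2 * i + 2)
    rw [hUW] at h
    obtain ⟨m, hm⟩ := mem_iUnion_cylinder.1 h
    obtain ⟨N, hN⟩ := hw.exists_recode_eq m
    exact ⟨N, by simpa only [W', Set.mem_ofPred_eq, hN] using hm⟩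

end Preservation

/-! ### The composition at the zero sequence -/

section Composition

/-- A sequence of labels without `1` does not have the same output as a sequence with
infinitely many entries `1`. -/
theorem eraseTwos_ne {a b : InfSeq 3} (ha : ∀ k, a k ≠ 1) (hb : ∀ K, ∃ k ≥ K, b k = 1) :
    eraseTwos a ≠ eraseTwos b := by
  intro h
  have hbdom : {k | b k ≠ 2}.Infinite := by
    refine Set.infinite_of_not_bddAbove fun ⟨B, hB⟩ => ?_
    obtain ⟨k, hk, h1⟩ := hb (B + 1)
    have := hB (show b k ≠ 2 by rw [h1]; decide)
    omega
  have hadom : (eraseTwos a).Dom := by rw [h]; exact hbdom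
  obtain ⟨k, -, hk⟩ := hb 0
  have hget : (eraseTwos a).get hadom (Nat.count (fun k => b k ≠ 2) k) =
      (eraseTwos b).get hbdom (Nat.count (fun k => b k ≠ 2) k) :=
    congrFun (Part.get_eq_get_of_eq _ hadom h) _
  simp only [eraseTwos, Nat.nth_count (p := fun k => b k ≠ 2) (show b k ≠ 2 by rw [hk]; decide),
    Fin.ext_iff, Fin.val_castLT, hk] at hget
  exact ha _ (Fin.ext hget)

theorem exists_comp_not_isRandomContinuous {F : InfSeq 2 →. InfSeq 2}
    (hF : IsRandomContinuous F) :
    ∃ G, IsRandomContinuous G ∧ ¬ IsRandomContinuous (G.comp F) := by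
  obtain ⟨x, hx, rfl⟩ := hF
  obtain ⟨w, hxw, hw⟩ := exists_isZeroOutput hx.infinite_zeroPos
  refine ⟨codedFun (recodeSeq w x), ⟨_, hx.recodeSeq hw, rfl⟩, ?_⟩
  rintro ⟨u, hu, h⟩
  have h0 := congrFun h fun _ => 0
  rw [PFun.comp_apply, hxw, codedFun_zero] at h0
  exact eraseTwos_ne (label_recodeSeq_ne_one w x) hu.exists_zeroPos_eq_one
    ((Part.bind_some w _).symm.trans h0)

/-- Without this the first clause could hold vacuously and would not refute closure under
composition. -/
theorem exists_isRandomContinuous : ∃ F, IsRandomContinuous F := by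
  obtain ⟨x, hx⟩ := (ae_mlRandom (n := 3)).exists
  exact ⟨_, x, hx, rfl⟩

end Composition

end RandomFun

theorem mainTheorem2 :
    (∀ F : RandomFun.InfSeq 2 →. RandomFun.InfSeq 2, RandomFun.IsRandomContinuous F →
      ∃ G : RandomFun.InfSeq 2 →. RandomFun.InfSeq 2,
        RandomFun.IsRandomContinuous G ∧ ¬ RandomFun.IsRandomContinuous (G.comp F)) ∧
    ¬ (∀ F G : RandomFun.InfSeq 2 →. RandomFun.InfSeq 2,
        RandomFun.IsRandomContinuous F → RandomFun.IsRandomContinuous G →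
          RandomFun.IsRandomContinuous (G.comp F)) := by
  refine ⟨fun F hF => RandomFun.exists_comp_not_isRandomContinuous hF, fun h => ?_⟩
  obtain ⟨F, hF⟩ := RandomFun.exists_isRandomContinuous
  obtain ⟨G, hG, hGF⟩ := RandomFun.exists_comp_not_isRandomContinuous hF
  exact hGF (h F G hF hG)
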